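/- Let $q\ge 1$, let $\mathbb{S}^q=\{x\in\mathbb{R}^{q+1}:\|x\|=1\}$ with surface area measure $\sigma_q$, and let $\nu_q=\sigma_q/\sigma_q(\mathbb{S}^q)$ be the uniform distribution. For $\kappa>0$ and $0<\rho<1$ put $$\psi_1(\theta;\kappa)=\exp(\kappa(\cos\theta-1)),\qquad \psi_2(\theta;\rho)=\frac{1-\rho^2}{(1-2\rho\cos\theta+\rho^2)^{(q+1)/2}}.$$ For an iid sample $X_1,\dots,X_n$ on $\mathbb{S}^q$ with angles $\theta_{ij}=\cos^{-1}(X_i'X_j)$, and $\ell\in\{1,2\}$, let $$T_{n,\ell}=\frac2n\sum_{1\le i<j\le n}\bigl(\psi_\ell(\theta_{ij})-\mathbb{E}_{\mathcal{H}_0}[\psi_\ell(\theta_{12})]\bigr),$$ where $\mathcal{H}_0$ is the hypothesis that the $X_i$ have distribution $\nu_q$. Let $P\ne\nu_q$ be any probability distribution on $\mathbb{S}^q$ that has a square-integrable density with respect to $\sigma_q$. Then, for every $\kappa>0$, the test that rejects $\mathcal{H}_0$ for large values of $T_{n,1}(\kappa)$ is consistent against $P$, and, for every $0<\rho<1$,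 the test that rejects $\mathcal{H}_0$ for large values of $T_{n,2}(\rho)$ is consistent against $P$. Here consistency means that for every significance level $\alpha\in(0,1)$ the power satisfies $\mathbb{P}_P[T_{n,\ell}>c_n]\to1$ as $n\to\infty$, both when $c_n$ is the exact upper $\alpha$-quantile $\inf\{c:\mathbb{P}_{\mathcal{H}_0}[T_{n,\ell}>c]\le\alpha\}$ of $T_{n,\ell}$ under $\mathcal{H}_0$, and for every sequence of critical values $c_n$ with $\mathbb{P}_{\mathcal{H}_0}[T_{n,\ell}>c_n]\to\alpha$. -/

import Mathlib

open MeasureTheory Filter Topology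

noncomputable section

/-- The unit hypersphere `S^q` in `ℝ^(q+1)`. -/
abbrev Sph (q : ℕ) : Type := Metric.sphere (0 : EuclideanSpace ℝ (Fin (q + 1))) 1

/-- The Lebesgue (surface area) measure `σ_q` on `S^q`. -/
def surfaceMeasure (q : ℕ) : Measure (Sph q) :=
  (volume : Measure (EuclideanSpace ℝ (Fin (q + 1)))).toSphere

/-- The uniform distribution `ν_q` on `S^q`. -/
def uniformSph (q : ℕ) : Measure (Sph q) :=
  (surfaceMeasure q Set.univ)⁻¹ • surfaceMeasure q

/-- The shortest angle between two points of the sphere. -/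
def sphAngle {q : ℕ} (x y : Sph q) : ℝ :=
  Real.arccos (inner ℝ (x : EuclideanSpace ℝ (Fin (q + 1))) (y : EuclideanSpace ℝ (Fin (q + 1))))

/-- The smooth maximum kernel, as a function of the angle. -/
def smoothMaxKernel (κ θ : ℝ) : ℝ := Real.exp (κ * (Real.cos θ - 1))

/-- The Poisson kernel on `S^q`, as a function of the angle. -/
def poissonKernelSph (q : ℕ) (ρ θ : ℝ) : ℝ :=
  (1 - ρ ^ 2) / (1 - 2 * ρ * Real.cos θ + ρ ^ 2) ^ (((q : ℝ) + 1) / 2)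

/-- The expectation of `ψ (θ₁₂)` when the two points are independent and uniform. -/
def nullMean (q : ℕ) (ψ : ℝ → ℝ) : ℝ :=
  ∫ p : Sph q × Sph q, ψ (sphAngle p.1 p.2) ∂((uniformSph q).prod (uniformSph q))

/-- The statistic `(2 / n) ∑_{i < j} (ψ (θ_ij) - E₀[ψ (θ₁₂)])` of the sample `x`. -/
def sphStat (q : ℕ) (ψ : ℝ → ℝ) (n : ℕ) (x : Fin n → Sph q) : ℝ :=
  2 / (n : ℝ) * ∑ i : Fin n, ∑ j ∈ Finset.Ioi i, (ψ (sphAngle (x i) (x j)) - nullMean q ψ)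

/-- The smooth maximum statistic `T_{n,1}(κ)`. -/
def smoothMaxStat (q : ℕ) (κ : ℝ) (n : ℕ) (x : Fin n → Sph q) : ℝ :=
  sphStat q (smoothMaxKernel κ) n x

/-- The Poisson kernel statistic `T_{n,2}(ρ)`. -/
def poissonStat (q : ℕ) (ρ : ℝ) (n : ℕ) (x : Fin n → Sph q) : ℝ :=
  sphStat q (poissonKernelSph q ρ) n x

/-- The probability that `T n > c` for an iid sample of size `n` from `P`. -/
def rejectProb {q : ℕ} (T : (n : ℕ) → (Fin n → Sph q) → ℝ) (P : Measure (Sph q))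
    (n : ℕ) (c : ℝ) : ℝ :=
  (Measure.pi fun _ : Fin n => P).real {x | c < T n x}

/-- The exact upper `α`-quantile of `T n` under uniformity. -/
def exactCritical {q : ℕ} (T : (n : ℕ) → (Fin n → Sph q) → ℝ) (α : ℝ) (n : ℕ) : ℝ :=
  sInf {c : ℝ | rejectProb T (uniformSph q) n c ≤ α}

/-- Consistency against `P` of the test of uniformity that rejects for large values of `T n`:
at every significance level the power tends to one. This is required both for the exact
critical values and for every sequence of critical values that attains the level
asymptotically. -/
def IsConsistentAgainst {q : ℕ} (T : (n : ℕ) → (Fin n → Sph q) → ℝ) (P : Measure (Sph q)) :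
    Prop :=
  ∀ α : ℝ, 0 < α → α < 1 →
    Tendsto (fun n => rejectProb T P n (exactCritical T α n)) atTop (𝓝 1) ∧
    ∀ c : ℕ → ℝ, Tendsto (fun n => rejectProb T (uniformSph q) n (c n)) atTop (𝓝 α) →
      Tendsto (fun n => rejectProb T P n (c n)) atTop (𝓝 1)

/-- `P` has a square-integrable probability density function with respect to `σ_q`. -/
def HasSqIntegrablePdf {q : ℕ} (P : Measure (Sph q)) : Prop :=
  ∃ f : Sph q → ℝ, Measurable f ∧ (∀ x, 0 ≤ f x) ∧ MemLp f 2 (surfaceMeasure q) ∧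
    P = (surfaceMeasure q).withDensity fun x => ENNReal.ofReal (f x)

end

/-! Both kernels have the form `g ⟨x, y⟩`, where `g` is a power series with strictly positive,
summable coefficients `a k`. Expanding `⟨x, y⟩ ^ k` in monomials turns `E_PP - 2 E_PQ + E_QQ`
(kernel means under product measures) into the sum over `k` of `a k` times the squared differences
of the degree-`k` moments of `P` and `Q`. Moments determine a measure on the sphere, so this is
positive when `P ≠ Q` (`integral_dotProductKernel_sub_pos`). For `Q` uniform, rotation invariance
gives `E_PQ = E_QQ`, leaving a gap `δ = E_PP - E_QQ > 0`.

By the weak law `tendsto_uStatistic_deviation`, `T_n / n` tends in probability to `δ` under `P` and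
to `0` under uniformity. Critical values are therefore eventually at most `δ n / 2`, a threshold
with power tending to one (`isConsistentAgainst_sphStat`). -/

/-! ### Weak law for U-statistics with bounded kernel. -/

section UStatistic

open ProbabilityTheory

variable {X : Type*} [MeasurableSpace X]

theorem sum_card_Ioi_fin (n : ℕ) :
    ∑ i : Fin n, ((Finset.Ioi i).card : ℝ) = (n : ℝ) * (n - 1) / 2 := by
  have h : (∑ i : Fin n, (Finset.Ioi i).card) * 2 = n * (n - 1) := by
    simp only [Fin.card_Ioi]
    rw [Fin.sum_univ_eq_sum_range (fun i => n - 1 - i), Finset.sum_range_reflect (fun i => i) n,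
      Finset.sum_range_id_mul_two]
  rcases n with _ | n
  · simp
  · have h' := congrArg (Nat.cast : ℕ → ℝ) h
    push_cast at h' ⊢
    linarith

theorem map_pi_pair_eq_prod {n : ℕ} (P : Measure X) [IsProbabilityMeasure P] {i j : Fin n}
    (hij : i ≠ j) :
    (Measure.pi fun _ : Fin n => P).map (fun x => (x i, x j)) = P.prod P := by
  have hind : iIndepFun (fun (i : Fin n) (x : Fin n → X) => x i) (Measure.pi fun _ => P) :=
    iIndepFun_pi (X := fun _ => id) fun _ => aemeasurable_id
  have h := (indepFun_iff_map_prod_eq_prod_map_map (measurable_pi_apply i).aemeasurable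
    (measurable_pi_apply j).aemeasurable).1 (hind.indepFun hij)
  rw [h, (measurePreserving_eval (fun _ : Fin n => P) i).map_eq,
    (measurePreserving_eval (fun _ : Fin n => P) j).map_eq]

theorem abs_covariance_le_of_bounded {Ω : Type*} [MeasurableSpace Ω] (μ : Measure Ω)
    [IsProbabilityMeasure μ] {Y Z : Ω → ℝ} {M : ℝ} (hY : ∀ ω, |Y ω| ≤ M) (hZ : ∀ ω, |Z ω| ≤ M) :
    |cov[Y, Z; μ]| ≤ 4 * M ^ 2 := by
  have hmean : ∀ W : Ω → ℝ, (∀ ω, |W ω| ≤ M) → |∫ ω, W ω ∂μ| ≤ M := fun W hW => by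
    simpa using norm_integral_le_of_norm_le_const (μ := μ) (f := W) (C := M)
      (Eventually.of_forall hW)
  have hdev : ∀ W : Ω → ℝ, (∀ ω, |W ω| ≤ M) → ∀ ω, |W ω - ∫ ω, W ω ∂μ| ≤ 2 * M :=
    fun W hW ω => (abs_sub _ _).trans (by linarith [hW ω, hmean W hW])
  have h := norm_integral_le_of_norm_le_const (μ := μ) (C := 4 * M ^ 2)
    (f := fun ω => (Y ω - ∫ ω, Y ω ∂μ) * (Z ω - ∫ ω, Z ω ∂μ)) (Eventually.of_forall fun ω => by
      rw [Real.norm_eq_abs, abs_mul]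
      have := mul_le_mul (hdev Y hY ω) (hdev Z hZ ω) (abs_nonneg _)
        ((abs_nonneg _).trans (hdev Y hY ω))
      linarith)
  simpa [covariance] using h

/-- The kernel evaluated at the pair `p` of sample points, for pairs in increasing order. -/
noncomputable def pairTerm {S : Type*} (K : S → S → ℝ) {n : ℕ} (p : Fin n × Fin n)
    (x : Fin n → S) : ℝ :=
  if p.1 < p.2 then K (x p.1) (x p.2) else 0

theorem sum_pairTerm {S : Type*} (K : S → S → ℝ) {n : ℕ} (x : Fin n → S) :
    ∑ p, pairTerm K p x = ∑ i : Fin n, ∑ j ∈ Finset.Ioi i, K (x i) (x j) := by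
  rw [Fintype.sum_prod_type]
  refine Finset.sum_congr rfl fun i _ => ?_
  simp only [pairTerm, ← Finset.sum_filter]
  refine Finset.sum_congr ?_ fun _ _ => rfl
  ext j
  simp

theorem measurable_pairTerm {K : X → X → ℝ} (hK : Measurable (Function.uncurry K)) {n : ℕ}
    (p : Fin n × Fin n) : Measurable (pairTerm K p) := by
  unfold pairTerm
  split_ifs
  · exact hK.comp (g := Function.uncurry K) (f := fun x : Fin n → X => (x p.1, x p.2)) (by fun_prop)
  · exact measurable_const

theorem abs_pairTerm_le {S : Type*} {K : S → S → ℝ} {M : ℝ} (hM : 0 ≤ M) (hb : ∀ x y, |K x y| ≤ M) {n : ℕ}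
    (p : Fin n × Fin n) (x : Fin n → S) : |pairTerm K p x| ≤ M := by
  unfold pairTerm
  split_ifs
  · exact hb _ _
  · simpa using hM

theorem memLp_pairTerm (P : Measure X) [IsProbabilityMeasure P] {K : X → X → ℝ} {M : ℝ}
    (hK : Measurable (Function.uncurry K)) (hM : 0 ≤ M) (hb : ∀ x y, |K x y| ≤ M) {n : ℕ}
    (p : Fin n × Fin n) : MemLp (pairTerm K p) 2 (Measure.pi fun _ : Fin n => P) :=
  MemLp.of_bound (measurable_pairTerm hK p).aestronglyMeasurable M
    (Eventually.of_forall fun x => abs_pairTerm_le hM hb p x)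

theorem integral_pairTerm (P : Measure X) [IsProbabilityMeasure P] {K : X → X → ℝ}
    (hK : Measurable (Function.uncurry K)) {n : ℕ} (p : Fin n × Fin n) :
    ∫ x, pairTerm K p x ∂(Measure.pi fun _ : Fin n => P) =
      if p.1 < p.2 then ∫ z, K z.1 z.2 ∂(P.prod P) else 0 := by
  unfold pairTerm
  split_ifs with h
  · rw [← map_pi_pair_eq_prod P h.ne, integral_map (by fun_prop)
      (by exact hK.aestronglyMeasurable)]
  · simp

theorem integral_sum_pairTerm (P : Measure X) [IsProbabilityMeasure P] {K : X → X → ℝ} {M : ℝ}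
    (hK : Measurable (Function.uncurry K)) (hM : 0 ≤ M) (hb : ∀ x y, |K x y| ≤ M) (n : ℕ) :
    ∫ x, ∑ p, pairTerm K p x ∂(Measure.pi fun _ : Fin n => P) =
      (n : ℝ) * (n - 1) / 2 * ∫ z, K z.1 z.2 ∂(P.prod P) := by
  rw [integral_finsetSum _ fun p _ => (memLp_pairTerm P hK hM hb p).integrable (by norm_num)]
  simp only [integral_pairTerm P hK]
  -- A constant kernel on a one-point space counts the increasing pairs.
  have h := sum_pairTerm (fun _ _ => ∫ z, K z.1 z.2 ∂(P.prod P))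
    (fun _ : Fin n => ())
  simp only [pairTerm] at h
  rw [h, ← sum_card_Ioi_fin, Finset.sum_mul]
  simp

/-- Pairs with no common index are independent; otherwise some indicator equals one and the crude
covariance bound suffices. -/
theorem covariance_pairTerm_le (P : Measure X) [IsProbabilityMeasure P] {K : X → X → ℝ} {M : ℝ}
    (hK : Measurable (Function.uncurry K)) (hM : 0 ≤ M) (hb : ∀ x y, |K x y| ≤ M) {n : ℕ}
    (p r : Fin n × Fin n) :
    cov[pairTerm K p, pairTerm K r; Measure.pi fun _ : Fin n => P] ≤
      4 * M ^ 2 * ((if p.1 = r.1 then 1 else 0) + (if p.1 = r.2 then 1 else 0) +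
        (if p.2 = r.1 then 1 else 0) + (if p.2 = r.2 then 1 else 0)) := by
  by_cases h : p.1 ≠ r.1 ∧ p.1 ≠ r.2 ∧ p.2 ≠ r.1 ∧ p.2 ≠ r.2
  · obtain ⟨h1, h2, h3, h4⟩ := h
    have hind : iIndepFun (fun (i : Fin n) (x : Fin n → X) => x i) (Measure.pi fun _ => P) :=
      iIndepFun_pi (X := fun _ => id) fun _ => aemeasurable_id
    have hpair := hind.indepFun_prodMk_prodMk (fun i => measurable_pi_apply i)
      p.1 p.2 r.1 r.2 h1 h2 h3 h4
    have hφ : ∀ s : Fin n × Fin n, Measurable fun z : X × X => if s.1 < s.2 then K z.1 z.2 else 0 :=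
      fun s => by
        split_ifs
        · exact hK
        · exact measurable_const
    have hcomp : IndepFun (pairTerm K p) (pairTerm K r) (Measure.pi fun _ : Fin n => P) :=
      hpair.comp (hφ p) (hφ r)
    rw [hcomp.covariance_eq_zero (memLp_pairTerm P hK hM hb p) (memLp_pairTerm P hK hM hb r)]
    positivity
  · refine (le_abs_self _).trans ((abs_covariance_le_of_bounded _ (abs_pairTerm_le hM hb p)
      (abs_pairTerm_le hM hb r)).trans ?_)
    refine le_mul_of_one_le_right (by positivity) ?_
    split_ifs <;> first | exact absurd ⟨‹_›, ‹_›, ‹_›, ‹_›⟩ h | norm_num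

/-- Each of the four coincidences of indices leaves `n ^ 3` of the `n ^ 4` quadruples. -/
theorem variance_sum_pairTerm_le (P : Measure X) [IsProbabilityMeasure P] {K : X → X → ℝ} {M : ℝ}
    (hK : Measurable (Function.uncurry K)) (hM : 0 ≤ M) (hb : ∀ x y, |K x y| ≤ M) (n : ℕ) :
    Var[fun x => ∑ p, pairTerm K p x; Measure.pi fun _ : Fin n => P] ≤
      16 * M ^ 2 * (n : ℝ) ^ 3 := by
  rw [variance_fun_sum fun p => memLp_pairTerm P hK hM hb p]
  refine (Finset.sum_le_sum fun p _ => Finset.sum_le_sum fun r _ =>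
    covariance_pairTerm_le P hK hM hb p r).trans (le_of_eq ?_)
  -- The indicator is made opaque so that only its row sums enter.
  obtain ⟨e, he⟩ : ∃ e : Fin n → Fin n → ℝ, ∀ i j, e i j = if i = j then 1 else 0 :=
    ⟨_, fun _ _ => rfl⟩
  have hsum : ∀ i, ∑ j, e i j = 1 := fun i => by simp [he]
  simp only [← he, ← Finset.mul_sum, Finset.sum_add_distrib, Fintype.sum_prod_type]
  simp [← Finset.mul_sum, hsum]
  ring

/-- Weak law of large numbers for U-statistics with bounded kernel. -/
theorem tendsto_uStatistic_deviation (P : Measure X) [IsProbabilityMeasure P] {K : X → X → ℝ}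
    {M : ℝ} (hK : Measurable (Function.uncurry K)) (hb : ∀ x y, |K x y| ≤ M) {ε : ℝ}
    (hε : 0 < ε) :
    Tendsto (fun n : ℕ => (Measure.pi fun _ : Fin n => P).real
      {x | ε * (n : ℝ) ^ 2 ≤ |∑ i : Fin n, ∑ j ∈ Finset.Ioi i, K (x i) (x j) -
        (n : ℝ) * (n - 1) / 2 * ∫ z, K z.1 z.2 ∂(P.prod P)|}) atTop (𝓝 0) := by
  have hM : 0 ≤ M := by
    obtain ⟨x⟩ := P.nonempty_of_neZero
    exact (abs_nonneg _).trans (hb x x)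
  have hlim : Tendsto (fun n : ℕ => 16 * M ^ 2 / ε ^ 2 * (1 / (n : ℝ))) atTop (𝓝 0) := by
    simpa only [mul_zero] using
      (tendsto_one_div_atTop_nhds_zero_nat (𝕜 := ℝ)).const_mul (16 * M ^ 2 / ε ^ 2)
  refine squeeze_zero' (Eventually.of_forall fun _ => measureReal_nonneg) ?_ hlim
  filter_upwards [eventually_gt_atTop 0] with n hn
  have hn' : (0 : ℝ) < n := by exact_mod_cast hn
  have hmem : MemLp (fun x : Fin n → X => ∑ p, pairTerm K p x) 2 (Measure.pi fun _ : Fin n => P) :=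
    memLp_finsetSum _ fun p _ => memLp_pairTerm P hK hM hb p
  have hcheb := meas_ge_le_variance_div_sq hmem (c := ε * (n : ℝ) ^ 2) (by positivity)
  rw [integral_sum_pairTerm P hK hM hb n] at hcheb
  simp only [sum_pairTerm] at hcheb
  refine (ENNReal.toReal_le_of_le_ofReal (div_nonneg (variance_nonneg _ _) (by positivity))
    hcheb).trans ?_
  have hvar := variance_sum_pairTerm_le P hK hM hb n
  simp only [sum_pairTerm] at hvar
  calc _ ≤ 16 * M ^ 2 * (n : ℝ) ^ 3 / (ε * (n : ℝ) ^ 2) ^ 2 := by gcongr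
    _ = _ := by field_simp

end UStatistic

/-! ### Consistency from a gap between kernel means. -/

theorem measurable_sphAngle {q : ℕ} :
    Measurable (Function.uncurry (sphAngle : Sph q → Sph q → ℝ)) := by
  unfold sphAngle Function.uncurry
  fun_prop

theorem isConsistentAgainst_sphStat {q : ℕ} (P : Measure (Sph q)) [IsProbabilityMeasure P]
    [IsProbabilityMeasure (uniformSph q)] {ψ : ℝ → ℝ} (hψ : Measurable ψ) {M : ℝ}
    (hM : ∀ θ, |ψ θ| ≤ M)
    (hpos : nullMean q ψ < ∫ p : Sph q × Sph q, ψ (sphAngle p.1 p.2) ∂(P.prod P)) :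
    IsConsistentAgainst (sphStat q ψ) P := by
  set K : Sph q → Sph q → ℝ := fun x y => ψ (sphAngle x y) - nullMean q ψ with hKdef
  have hψm : Measurable fun p : Sph q × Sph q => ψ (sphAngle p.1 p.2) :=
    hψ.comp measurable_sphAngle
  have hK : Measurable (Function.uncurry K) := hψm.sub_const _
  have hb : ∀ x y, |K x y| ≤ M + |nullMean q ψ| := fun x y =>
    (abs_sub _ _).trans (add_le_add_left (hM _) _)
  have hint : ∀ Q : Measure (Sph q), IsProbabilityMeasure Q →
      ∫ z, K z.1 z.2 ∂(Q.prod Q) =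
        ∫ p : Sph q × Sph q, ψ (sphAngle p.1 p.2) ∂(Q.prod Q) - nullMean q ψ := fun Q _ => by
    simp only [hKdef]
    rw [integral_sub (Integrable.of_bound hψm.aestronglyMeasurable M
      (Eventually.of_forall fun _ => hM _)) (integrable_const _)]
    simp
  have hnull : ∫ z, K z.1 z.2 ∂((uniformSph q).prod (uniformSph q)) = 0 := by
    rw [hint _ inferInstance]; exact sub_self _
  set δ := ∫ z, K z.1 z.2 ∂(P.prod P) with hδdef
  have hδ : 0 < δ := by rw [hδdef, hint P inferInstance]; linarith
  have hstat : ∀ (n : ℕ) (x : Fin n → Sph q), sphStat q ψ n x =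
      2 / (n : ℝ) * ∑ i : Fin n, ∑ j ∈ Finset.Ioi i, K (x i) (x j) := fun _ _ => rfl
  have hH0 : Tendsto (fun n : ℕ => rejectProb (sphStat q ψ) (uniformSph q) n (δ / 2 * n))
      atTop (𝓝 0) := by
    -- `T_n > δ n / 2` says that the double sum, centred under uniformity, exceeds `δ n ^ 2 / 4`.
    have h := tendsto_uStatistic_deviation (uniformSph q) hK hb (ε := δ / 4) (by positivity)
    refine squeeze_zero' (Eventually.of_forall fun _ => measureReal_nonneg) ?_ h
    filter_upwards [eventually_gt_atTop 0] with n hn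
    have hn' : (0 : ℝ) < n := by exact_mod_cast hn
    refine measureReal_mono fun x hx => ?_
    simp only [Set.mem_ofPred_eq, hstat, hnull] at hx ⊢
    rw [div_mul_eq_mul_div 2, lt_div_iff₀ hn'] at hx
    refine le_trans ?_ (le_abs_self _)
    linarith
  have hH1 : Tendsto (fun n : ℕ => rejectProb (sphStat q ψ) P n (δ / 2 * n)) atTop (𝓝 1) := by
    -- If `T_n ≤ δ n / 2`, the double sum is below its mean by at least `δ n ^ 2 / 4 - δ n / 2`,
    -- which is at least `δ n ^ 2 / 8` once `n ≥ 4`.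
    have h := tendsto_uStatistic_deviation P hK hb (ε := δ / 8) (by positivity)
    have h' : Tendsto (fun n : ℕ => 1 - (Measure.pi fun _ : Fin n => P).real
      {x | δ / 8 * (n : ℝ) ^ 2 ≤ |∑ i : Fin n, ∑ j ∈ Finset.Ioi i, K (x i) (x j) -
        (n : ℝ) * (n - 1) / 2 * δ|}) atTop (𝓝 1) := by
      simpa using h.const_sub 1
    refine tendsto_of_tendsto_of_tendsto_of_le_of_le' h' tendsto_const_nhds ?_
      (Eventually.of_forall fun _ => measureReal_le_one)
    filter_upwards [eventually_ge_atTop 4] with n hn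
    have hn' : (4 : ℝ) ≤ n := by exact_mod_cast hn
    have hcover : (Set.univ : Set (Fin n → Sph q)) ⊆
        {x | δ / 2 * n < sphStat q ψ n x} ∪ {x | δ / 8 * (n : ℝ) ^ 2 ≤
          |∑ i : Fin n, ∑ j ∈ Finset.Ioi i, K (x i) (x j) - (n : ℝ) * (n - 1) / 2 * δ|} := by
      intro x _
      by_cases hx : δ / 2 * n < sphStat q ψ n x
      · exact Or.inl hx
      · right
        simp only [Set.mem_ofPred_eq]
        rw [not_lt, hstat, div_mul_eq_mul_div 2, div_le_iff₀ (by linarith)] at hx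
        refine le_trans ?_ (neg_le_abs _)
        nlinarith [mul_nonneg (mul_nonneg hδ.le (by linarith : (0 : ℝ) ≤ n))
          (by linarith : (0 : ℝ) ≤ n - 4)]
    have hle := (measureReal_mono (μ := Measure.pi fun _ : Fin n => P) hcover).trans
      (measureReal_union_le _ _)
    rw [probReal_univ] at hle
    simp only [rejectProb]
    linarith
  have key : ∀ c : ℕ → ℝ, (∀ᶠ n in atTop, c n ≤ δ / 2 * n) →
      Tendsto (fun n => rejectProb (sphStat q ψ) P n (c n)) atTop (𝓝 1) := fun c hc => by
    refine tendsto_of_tendsto_of_tendsto_of_le_of_le' hH1 tendsto_const_nhds ?_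
      (Eventually.of_forall fun _ => measureReal_le_one)
    filter_upwards [hc] with n hn
    exact measureReal_mono fun x (hx : _ < _) => lt_of_le_of_lt hn hx
  intro α hα _
  refine ⟨key _ ?_, fun c hc => key c ?_⟩
  · filter_upwards [hH0.eventually_lt_const hα] with n hn
    unfold exactCritical
    by_cases hbdd : BddBelow {c | rejectProb (sphStat q ψ) (uniformSph q) n c ≤ α}
    · exact csInf_le hbdd hn.le
    -- Here `sInf` takes its default value `0`, still below the threshold.
    · rw [Real.sInf_of_not_bddBelow hbdd]
      positivity
  -- A critical value above `δ n / 2` would have level below `α / 2`.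
  · filter_upwards [hH0.eventually_lt_const (half_pos hα),
      hc.eventually_const_lt (half_lt_self hα)] with n h0 h1
    by_contra! hlt
    have : rejectProb (sphStat q ψ) (uniformSph q) n (c n) ≤
        rejectProb (sphStat q ψ) (uniformSph q) n (δ / 2 * n) :=
      measureReal_mono fun x (hx : _ < _) => hlt.trans hx
    linarith

/-! ### Rotation invariance of the uniform distribution. -/

open scoped Pointwise in
-- `toSphere` measures a set through the volume of the cone over it, and an isometry carries cones
-- to cones, preserving volume.
theorem map_toSphere_linearIsometryEquiv {q : ℕ}
    (e : EuclideanSpace ℝ (Fin (q + 1)) ≃ₗᵢ[ℝ] EuclideanSpace ℝ (Fin (q + 1)))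
    {f : Sph q → Sph q} (hf : ∀ x, (f x : EuclideanSpace ℝ (Fin (q + 1))) = e x) :
    (surfaceMeasure q).map f = surfaceMeasure q := by
  have hfm : Measurable f := by
    refine Measurable.subtype_mk (f := fun x => (f x : EuclideanSpace ℝ (Fin (q + 1)))) ?_
    simp only [hf]
    exact e.continuous.measurable.comp measurable_subtype_coe
  ext s hs
  rw [Measure.map_apply hfm hs, surfaceMeasure, Measure.toSphere_apply' _ (hfm hs),
    Measure.toSphere_apply' _ hs]
  congr 1
  have hset : Set.Ioo (0 : ℝ) 1 • ((↑) '' (f ⁻¹' s) : Set (EuclideanSpace ℝ (Fin (q + 1)))) =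
      e ⁻¹' (Set.Ioo (0 : ℝ) 1 • ((↑) '' s)) := by
    ext v
    simp only [Set.mem_smul, Set.mem_preimage, Set.mem_image]
    constructor
    · rintro ⟨r, hr, _, ⟨x, hx, rfl⟩, rfl⟩
      exact ⟨r, hr, _, ⟨f x, hx, rfl⟩, by rw [hf, map_smul]⟩
    · rintro ⟨r, hr, _, ⟨y, hy, rfl⟩, hv⟩
      have hx : e.symm (y : EuclideanSpace ℝ (Fin (q + 1))) ∈ Metric.sphere 0 1 := by simp
      refine ⟨r, hr, _, ⟨⟨_, hx⟩, ?_, rfl⟩, ?_⟩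
      · have : f ⟨_, hx⟩ = y := Subtype.ext (by simp [hf])
        simpa [this] using hy
      · apply e.injective
        simp [hv]
  rw [hset]
  exact e.measurePreserving.measure_preimage_equiv (f := e.toMeasurableEquiv) _

instance isProbabilityMeasure_uniformSph (q : ℕ) : IsProbabilityMeasure (uniformSph q) := by
  have : IsFiniteMeasure (surfaceMeasure q) := by unfold surfaceMeasure; infer_instance
  constructor
  rw [uniformSph, Measure.smul_apply, smul_eq_mul]
  refine ENNReal.inv_mul_cancel ?_ (measure_ne_top _ _)
  rw [Measure.measure_univ_ne_zero]
  exact Measure.toSphere_ne_zero _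

theorem integral_uniformSph_inner_eq (q : ℕ) (g : ℝ → ℝ) (x x' : Sph q) :
    ∫ y : Sph q, g (inner ℝ (x : EuclideanSpace ℝ (Fin (q + 1))) y) ∂(uniformSph q) =
      ∫ y : Sph q, g (inner ℝ (x' : EuclideanSpace ℝ (Fin (q + 1))) y) ∂(uniformSph q) := by
  -- The reflection in the hyperplane orthogonal to `x - x'` carries `x` to `x'`.
  set e := (ℝ ∙ ((x : EuclideanSpace ℝ (Fin (q + 1))) - x'))ᗮ.reflection
  have hex : e x = x' := Submodule.reflection_sub (by simp)
  let f : Sph q ≃ₜ Sph q :=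
    { toFun := fun y => ⟨e y, by simp⟩
      invFun := fun y => ⟨e.symm y, by simp⟩
      left_inv := fun y => by simp
      right_inv := fun y => by simp
      continuous_toFun := by fun_prop
      continuous_invFun := by fun_prop }
  have hmap : (uniformSph q).map f = uniformSph q := by
    rw [uniformSph, Measure.map_smul, map_toSphere_linearIsometryEquiv e fun _ => rfl]
  conv_rhs => rw [← hmap, f.measurableEmbedding.integral_map]
  refine integral_congr_ae (Eventually.of_forall fun y => ?_)
  change g _ = g (inner ℝ _ (e y))
  rw [← hex, e.inner_map_map]

/-- The inner integral does not depend on the first point, so neither does the total on its law. -/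
theorem integral_prod_uniformSph_inner_eq (q : ℕ) {g : ℝ → ℝ} (P Q : Measure (Sph q))
    [IsProbabilityMeasure P] [IsProbabilityMeasure Q]
    (hg : ∀ R : Measure (Sph q), IsProbabilityMeasure R →
      Integrable (fun p : Sph q × Sph q => g (inner ℝ (p.1 : EuclideanSpace ℝ (Fin (q + 1))) p.2))
      (R.prod (uniformSph q))) :
    ∫ p : Sph q × Sph q, g (inner ℝ (p.1 : EuclideanSpace ℝ (Fin (q + 1))) p.2)
        ∂(P.prod (uniformSph q)) =
      ∫ p : Sph q × Sph q, g (inner ℝ (p.1 : EuclideanSpace ℝ (Fin (q + 1))) p.2)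
        ∂(Q.prod (uniformSph q)) := by
  obtain ⟨x₀⟩ := P.nonempty_of_neZero
  rw [integral_prod _ (hg P inferInstance), integral_prod _ (hg Q inferInstance)]
  simp only [integral_uniformSph_inner_eq q g _ x₀]
  simp

/-! ### Moments and positive definiteness of dot-product kernels. -/

/-- The monomial `∏ j, x_{p j}` as a function on the sphere. -/
def sphMonomial {q k : ℕ} (p : Fin k → Fin (q + 1)) (x : Sph q) : ℝ :=
  ∏ j, (x : EuclideanSpace ℝ (Fin (q + 1))) (p j)

theorem continuous_sphMonomial {q k : ℕ} (p : Fin k → Fin (q + 1)) :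
    Continuous (sphMonomial p : Sph q → ℝ) := by
  unfold sphMonomial
  fun_prop

theorem integrable_sphMonomial {q k : ℕ} (p : Fin k → Fin (q + 1)) (μ : Measure (Sph q))
    [IsFiniteMeasure μ] : Integrable (sphMonomial p) μ :=
  (continuous_sphMonomial p).integrable_of_hasCompactSupport
    (HasCompactSupport.of_compactSpace _)

/-- This separates the variables, so integrals against product measures become products of moments.
-/
theorem inner_pow_eq_sum_sphMonomial {q : ℕ} (k : ℕ) (x y : Sph q) :
    inner ℝ (x : EuclideanSpace ℝ (Fin (q + 1))) y ^ k =
      ∑ p : Fin k → Fin (q + 1), sphMonomial p x * sphMonomial p y := by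
  simp only [PiLp.inner_apply, Fintype.sum_pow, sphMonomial, ← Finset.prod_mul_distrib]
  refine Finset.sum_congr rfl fun p _ => Finset.prod_congr rfl fun j _ => ?_
  simp [mul_comm]

theorem abs_inner_sph_le_one {q : ℕ} (x y : Sph q) :
    |inner ℝ (x : EuclideanSpace ℝ (Fin (q + 1))) y| ≤ 1 := by
  simpa using abs_real_inner_le_norm (x : EuclideanSpace ℝ (Fin (q + 1))) y

theorem continuous_inner_sph {q : ℕ} : Continuous fun z : Sph q × Sph q =>
    inner ℝ (z.1 : EuclideanSpace ℝ (Fin (q + 1))) (z.2 : EuclideanSpace ℝ (Fin (q + 1))) := by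
  fun_prop

/-- A dot-product kernel given by a power series integrates termwise against moments. -/
theorem hasSum_integral_dotProductKernel {q : ℕ} {g : ℝ → ℝ} {a : ℕ → ℝ} (ha : ∀ k, 0 ≤ a k)
    (hsum : Summable a) (hg : ∀ t, |t| ≤ 1 → HasSum (fun k => a k * t ^ k) (g t))
    (μ₁ μ₂ : Measure (Sph q)) [IsProbabilityMeasure μ₁] [IsProbabilityMeasure μ₂] :
    HasSum (fun k => a k * ∑ p : Fin k → Fin (q + 1),
        (∫ x, sphMonomial p x ∂μ₁) * ∫ x, sphMonomial p x ∂μ₂)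
      (∫ z : Sph q × Sph q, g (inner ℝ (z.1 : EuclideanSpace ℝ (Fin (q + 1))) z.2)
        ∂(μ₁.prod μ₂)) := by
  set F : ℕ → Sph q × Sph q → ℝ := fun k z =>
    a k * inner ℝ (z.1 : EuclideanSpace ℝ (Fin (q + 1))) (z.2 : EuclideanSpace ℝ (Fin (q + 1))) ^ k
    with hF
  have hFc : ∀ k, Continuous (F k) := fun k =>
    continuous_const.mul (continuous_inner_sph.pow k)
  have hFb : ∀ k z, ‖F k z‖ ≤ a k := fun k z => by
    rw [hF, Real.norm_eq_abs, abs_mul, abs_pow, abs_of_nonneg (ha k)]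
    exact mul_le_of_le_one_right (ha k) (pow_le_one₀ (abs_nonneg _) (abs_inner_sph_le_one _ _))
  have hFi : ∀ k, Integrable (F k) (μ₁.prod μ₂) := fun k =>
    Integrable.of_bound (hFc k).aestronglyMeasurable (a k) (Eventually.of_forall (hFb k))
  have h := hasSum_integral_of_summable_integral_norm hFi
    (hsum.of_nonneg_of_le (fun k => integral_nonneg fun _ => norm_nonneg _) fun k => by
      have := integral_mono (hFi k).norm (integrable_const (a k)) (hFb k)
      simpa using this)
  have hlim : ∀ z, ∑' k, F k z = g (inner ℝ (z.1 : EuclideanSpace ℝ (Fin (q + 1))) z.2) :=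
    fun z => (hg _ (abs_inner_sph_le_one _ _)).tsum_eq
  rw [integral_congr_ae (Eventually.of_forall hlim)] at h
  refine h.congr_fun fun k => ?_
  simp only [hF, integral_const_mul, inner_pow_eq_sum_sphMonomial]
  rw [integral_finsetSum _ fun p _ =>
    (integrable_sphMonomial p μ₁).mul_prod (integrable_sphMonomial p μ₂)]
  simp only [integral_prod_mul]

/-- Probability measures on the sphere are determined by their moments. -/
theorem ext_of_integral_sphMonomial_eq {q : ℕ} (P Q : Measure (Sph q)) [IsProbabilityMeasure P]
    [IsProbabilityMeasure Q]
    (h : ∀ (k : ℕ) (p : Fin k → Fin (q + 1)),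
      ∫ x, sphMonomial p x ∂P = ∫ x, sphMonomial p x ∂Q) : P = Q := by
  let coord : Fin (q + 1) → BoundedContinuousFunction (Sph q) ℝ := fun i =>
    BoundedContinuousFunction.mkOfCompact
      ⟨fun x => (x : EuclideanSpace ℝ (Fin (q + 1))) i, by fun_prop⟩
  let A : StarSubalgebra ℝ (BoundedContinuousFunction (Sph q) ℝ) :=
    { Algebra.adjoin ℝ (Set.range coord) with
      star_mem' := fun {a} ha => by
        have : star a = a := by ext; simp
        rwa [this] }
  -- A subalgebra separating points determines the measure; the coordinates generate one.
  refine ext_of_forall_mem_subalgebra_integral_eq_of_pseudoEMetric_complete_countable (𝕜 := ℝ)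
    (A := A) ?_ ?_
  · intro x y hxy
    obtain ⟨i, hi⟩ : ∃ i, (x : EuclideanSpace ℝ (Fin (q + 1))) i ≠
        (y : EuclideanSpace ℝ (Fin (q + 1))) i := by
      by_contra! hall
      exact hxy (Subtype.ext (PiLp.ext hall))
    refine ⟨_, ⟨_, ⟨coord i, ?_, rfl⟩, rfl⟩, hi⟩
    exact Algebra.subset_adjoin ⟨i, rfl⟩
  · intro f hf
    have hf' : f ∈ Subalgebra.toSubmodule (Algebra.adjoin ℝ (Set.range coord)) := hf
    -- The subalgebra is the linear span of products of coordinates, so monomials suffice.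
    rw [Algebra.adjoin_eq_span] at hf'
    clear hf
    induction hf' using Submodule.span_induction with
    | mem f hf =>
      obtain ⟨l, hl, rfl⟩ := Submonoid.exists_list_of_mem_closure hf
      choose! idx hidx using hl
      have hmon : ∀ x, l.prod x = sphMonomial (fun j : Fin l.length => idx (l.get j)) x := by
        intro x
        have h1 : l.prod = ∏ j : Fin l.length, coord (idx (l.get j)) := by
          conv_lhs => rw [← List.ofFn_get l, List.prod_ofFn]
          exact Finset.prod_congr rfl fun j _ => (hidx _ (l.get_mem j)).symm
        rw [h1, BoundedContinuousFunction.coe_prod, Finset.prod_apply]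
        rfl
      simp only [hmon]
      exact h _ _
    | zero => simp
    | add f g _ _ hf hg =>
      simp only [BoundedContinuousFunction.coe_add, Pi.add_apply]
      rw [integral_add (f.integrable P) (g.integrable P), integral_add (f.integrable Q)
        (g.integrable Q), hf, hg]
    | smul c f _ hf =>
      simp only [BoundedContinuousFunction.coe_smul, integral_smul, hf]

/-- Strict positivity of every `a k` matters: the distinguishing moment may have any degree. -/
theorem integral_dotProductKernel_sub_pos {q : ℕ} {g : ℝ → ℝ} {a : ℕ → ℝ} (ha : ∀ k, 0 < a k)
    (hsum : Summable a) (hg : ∀ t, |t| ≤ 1 → HasSum (fun k => a k * t ^ k) (g t))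
    (P Q : Measure (Sph q)) [IsProbabilityMeasure P] [IsProbabilityMeasure Q] (hPQ : P ≠ Q) :
    0 < (∫ z : Sph q × Sph q, g (inner ℝ (z.1 : EuclideanSpace ℝ (Fin (q + 1))) z.2) ∂(P.prod P)) -
      2 * (∫ z : Sph q × Sph q, g (inner ℝ (z.1 : EuclideanSpace ℝ (Fin (q + 1))) z.2)
        ∂(P.prod Q)) +
      ∫ z : Sph q × Sph q, g (inner ℝ (z.1 : EuclideanSpace ℝ (Fin (q + 1))) z.2) ∂(Q.prod Q) := by
  have hH := fun (μ₁ μ₂ : Measure (Sph q)) (_ : IsProbabilityMeasure μ₁)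
    (_ : IsProbabilityMeasure μ₂) =>
    hasSum_integral_dotProductKernel (fun k => (ha k).le) hsum hg μ₁ μ₂
  have hS := ((hH P P inferInstance inferInstance).sub
    ((hH P Q inferInstance inferInstance).mul_left 2)).add (hH Q Q inferInstance inferInstance)
  have hS' : HasSum (fun k => a k * ∑ p : Fin k → Fin (q + 1),
      (∫ x, sphMonomial p x ∂P - ∫ x, sphMonomial p x ∂Q) ^ 2)
      (∫ z : Sph q × Sph q, g (inner ℝ (z.1 : EuclideanSpace ℝ (Fin (q + 1))) z.2) ∂(P.prod P) -
      2 * ∫ z : Sph q × Sph q, g (inner ℝ (z.1 : EuclideanSpace ℝ (Fin (q + 1))) z.2)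
        ∂(P.prod Q) +
      ∫ z : Sph q × Sph q, g (inner ℝ (z.1 : EuclideanSpace ℝ (Fin (q + 1))) z.2) ∂(Q.prod Q)) := by
    refine hS.congr_fun fun k => ?_
    have : ∀ p : Fin k → Fin (q + 1), (∫ x, sphMonomial p x ∂P - ∫ x, sphMonomial p x ∂Q) ^ 2 =
        (∫ x, sphMonomial p x ∂P) * (∫ x, sphMonomial p x ∂P) -
        2 * ((∫ x, sphMonomial p x ∂P) * (∫ x, sphMonomial p x ∂Q)) +
        (∫ x, sphMonomial p x ∂Q) * (∫ x, sphMonomial p x ∂Q) := fun p => by ring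
    simp only [this, Finset.sum_add_distrib, Finset.sum_sub_distrib, ← Finset.mul_sum]
    ring
  have hterm : ∀ k, 0 ≤ a k * ∑ p : Fin k → Fin (q + 1),
      (∫ x, sphMonomial p x ∂P - ∫ x, sphMonomial p x ∂Q) ^ 2 := fun k =>
    mul_nonneg (ha k).le (Finset.sum_nonneg fun _ _ => sq_nonneg _)
  obtain ⟨k, p, hkp⟩ : ∃ (k : ℕ) (p : Fin k → Fin (q + 1)),
      ∫ x, sphMonomial p x ∂P ≠ ∫ x, sphMonomial p x ∂Q := by
    by_contra! hall
    exact hPQ (ext_of_integral_sphMonomial_eq P Q hall)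
  rw [← hS'.tsum_eq]
  refine hS'.summable.tsum_pos hterm k (mul_pos (ha k) ?_)
  exact Finset.sum_pos' (fun _ _ => sq_nonneg _)
    ⟨p, Finset.mem_univ _, sq_pos_of_ne_zero (sub_ne_zero.2 hkp)⟩

/-! ### Power series of the two kernels. -/

theorem Ring.multichoose_pos_of_pos {a : ℝ} (ha : 0 < a) (n : ℕ) :
    0 < Ring.multichoose a n := by
  have h := Ring.factorial_nsmul_multichoose_eq_ascPochhammer a n
  rw [Polynomial.ascPochhammer_smeval_eq_eval, nsmul_eq_mul] at h
  have hp := ascPochhammer_pos n a ha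
  rw [← h] at hp
  exact pos_of_mul_pos_right hp (Nat.cast_nonneg _)

theorem hasSum_one_sub_rpow_neg {a t : ℝ} (ht : |t| < 1) :
    HasSum (fun k => Ring.multichoose a k * t ^ k) (1 / (1 - t) ^ a) := by
  have hmem : t ∈ Metric.eball (0 : ℝ) 1 := by
    simpa [enorm_eq_nnnorm, ← NNReal.coe_lt_coe] using ht
  have h := (Real.one_div_one_sub_rpow_hasFPowerSeriesOnBall_zero a).hasSum hmem
  simpa [Ring.multichoose_eq, FormalMultilinearSeries.ofScalars_apply_eq, mul_comm] using h

/-- `g` is the sum on `[-1, 1]` of an absolutely convergent power series with positive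
coefficients. -/
def IsPositivePowerSeries (g : ℝ → ℝ) : Prop :=
  ∃ a : ℕ → ℝ, (∀ k, 0 < a k) ∧ Summable a ∧
    ∀ t, |t| ≤ 1 → HasSum (fun k => a k * t ^ k) (g t)

theorem isPositivePowerSeries_smoothMax {κ : ℝ} (hκ : 0 < κ) :
    IsPositivePowerSeries fun t => Real.exp (κ * (t - 1)) := by
  have h : ∀ t : ℝ, HasSum (fun k : ℕ => Real.exp (-κ) * (κ ^ k / k.factorial) * t ^ k)
      (Real.exp (κ * (t - 1))) := fun t => by
    have h' := (NormedSpace.expSeries_div_hasSum_exp (𝔸 := ℝ) (κ * t)).mul_left (Real.exp (-κ))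
    rw [← Real.exp_eq_exp_ℝ, ← Real.exp_add] at h'
    rw [show κ * (t - 1) = -κ + κ * t by ring]
    refine h'.congr_fun fun k => ?_
    rw [mul_pow]
    ring
  exact ⟨_, fun k => by positivity, by simpa using (h 1).summable, fun t _ => h t⟩

theorem isPositivePowerSeries_poisson (q : ℕ) {ρ : ℝ} (h0 : 0 < ρ) (h1 : ρ < 1) :
    IsPositivePowerSeries fun t =>
      (1 - ρ ^ 2) / (1 - 2 * ρ * t + ρ ^ 2) ^ (((q : ℝ) + 1) / 2) := by
  set b : ℝ := ((q : ℝ) + 1) / 2 with hb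
  have hb0 : 0 < b := by positivity
  -- Chosen so that `1 - 2ρt + ρ² = (1 + ρ²)(1 - s t)`. Since `(1 - ρ)² > 0`, `s < 1`, and the
  -- binomial series converges even at `|t| = 1`.
  set s : ℝ := 2 * ρ / (1 + ρ ^ 2) with hs
  have hd : 0 < 1 + ρ ^ 2 := by positivity
  have hs0 : 0 < s := by positivity
  have hs1 : s < 1 := by rw [hs, div_lt_one hd]; nlinarith
  have hC : 0 < (1 - ρ ^ 2) / (1 + ρ ^ 2) ^ b :=
    div_pos (by nlinarith) (Real.rpow_pos_of_pos hd _)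
  have h : ∀ t : ℝ, |t| ≤ 1 → HasSum
      (fun k : ℕ => (1 - ρ ^ 2) / (1 + ρ ^ 2) ^ b * (Ring.multichoose b k * s ^ k) * t ^ k)
      ((1 - ρ ^ 2) / (1 - 2 * ρ * t + ρ ^ 2) ^ b) := fun t ht => by
    have hst : |s * t| < 1 := by
      rw [abs_mul, abs_of_pos hs0]
      exact (mul_le_of_le_one_right hs0.le ht).trans_lt hs1
    have hfac : 1 - 2 * ρ * t + ρ ^ 2 = (1 + ρ ^ 2) * (1 - s * t) := by
      rw [hs]
      field_simp
      ring
    rw [hfac, Real.mul_rpow hd.le (by linarith [(abs_lt.1 hst).2]),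
      show (1 - ρ ^ 2) / ((1 + ρ ^ 2) ^ b * (1 - s * t) ^ b) =
        (1 - ρ ^ 2) / (1 + ρ ^ 2) ^ b * (1 / (1 - s * t) ^ b) by rw [div_mul_div_comm, mul_one]]
    refine ((hasSum_one_sub_rpow_neg (a := b) hst).mul_left
      ((1 - ρ ^ 2) / (1 + ρ ^ 2) ^ b)).congr_fun fun k => ?_
    rw [mul_pow]
    ring
  refine ⟨_, fun k => mul_pos hC (mul_pos (Ring.multichoose_pos_of_pos hb0 k) (pow_pos hs0 k)),
    ?_, h⟩
  simpa using (h 1 (by simp)).summable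

/-! ### Assembly. -/

theorem cos_sphAngle {q : ℕ} (x y : Sph q) :
    Real.cos (sphAngle x y) = inner ℝ (x : EuclideanSpace ℝ (Fin (q + 1))) y := by
  have h := abs_le.1 (abs_inner_sph_le_one x y)
  exact Real.cos_arccos h.1 h.2

theorem isConsistentAgainst_of_isPositivePowerSeries {q : ℕ} (P : Measure (Sph q))
    [IsProbabilityMeasure P] (hP : P ≠ uniformSph q) {g : ℝ → ℝ} (hg : IsPositivePowerSeries g)
    (hgm : Measurable g) : IsConsistentAgainst (sphStat q fun θ => g (Real.cos θ)) P := by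
  obtain ⟨a, ha, hsum, hgs⟩ := hg
  have hb : ∀ t, |t| ≤ 1 → |g t| ≤ ∑' k, a k := fun t ht => by
    rw [← (hgs t ht).tsum_eq, ← Real.norm_eq_abs]
    refine tsum_of_norm_bounded hsum.hasSum fun k => ?_
    rw [Real.norm_eq_abs, abs_mul, abs_pow, abs_of_pos (ha k)]
    exact mul_le_of_le_one_right (ha k).le (pow_le_one₀ (abs_nonneg _) ht)
  have hint : ∀ R : Measure (Sph q), IsProbabilityMeasure R →
      Integrable (fun p : Sph q × Sph q => g (inner ℝ (p.1 : EuclideanSpace ℝ (Fin (q + 1))) p.2))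
      (R.prod (uniformSph q)) := fun R _ =>
    Integrable.of_bound (hgm.comp continuous_inner_sph.measurable).aestronglyMeasurable
      (∑' k, a k) (Eventually.of_forall fun _ => hb _ (abs_inner_sph_le_one _ _))
  refine isConsistentAgainst_sphStat P (hgm.comp Real.measurable_cos)
    (fun θ => hb _ (Real.abs_cos_le_one θ)) ?_
  have hpos := integral_dotProductKernel_sub_pos ha hsum hgs P (uniformSph q) hP
  -- The cross term becomes the null mean, leaving exactly the required gap.
  rw [integral_prod_uniformSph_inner_eq q P (uniformSph q) hint] at hpos
  simp only [nullMean, cos_sphAngle]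
  linarith

theorem corollary1 (q : ℕ) (hq : 1 ≤ q) (P : Measure (Sph q)) [IsProbabilityMeasure P]
    (hpdf : HasSqIntegrablePdf P) (hP : P ≠ uniformSph q) :
    (∀ κ : ℝ, 0 < κ → IsConsistentAgainst (smoothMaxStat q κ) P) ∧
      (∀ ρ : ℝ, 0 < ρ → ρ < 1 → IsConsistentAgainst (poissonStat q ρ) P) := by
  refine ⟨fun κ hκ => ?_, fun ρ h0 h1 => ?_⟩
  · have h := isConsistentAgainst_of_isPositivePowerSeries P hP
      (isPositivePowerSeries_smoothMax hκ) (by fun_prop)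
    exact h
  · have h := isConsistentAgainst_of_isPositivePowerSeries P hP
      (isPositivePowerSeries_poisson q h0 h1) (by fun_prop)
    exact h
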